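/- **Setting.** There are $n$ instances $x_1,\dots,x_n$ with unknown true labels $\sigma=(y_1,\dots,y_n)\in\{1,\dots,c\}^n$. A teacher $t$ gives each instance a name $t(x_i)\in\{1,\dots,c\}$ and is consistent with the true classes: $t(x_i)=t(x_j)\iff y_i=y_j$. The teachers are completely uncoordinated: nothing is assumed about the names different teachers use for a class. A distributed labeling algorithm is given $n$, $c$ and $l$; adaptively, and possibly using internal randomness, it asks teachers for the labels of instances, at most $l$ labels per teacher (from an unlimited supply of teachers), and for every $l\ge 2$, for all true labels and all class-consistent teachers, it must return $\bar y_1,\dots,\bar y_n$ with $\bar y_i=\bar y_j\iff y_i=y_j$. Let $\mathbf{labels}(\mathbf{alg},\sigma,l)$ be the number of labels it obtains from teachers, averaged over its internal randomness, for the worst class-consistent teachers. For real $\alpha>0$ let $$f(\alpha,\mathbf{alg})=\limsup_{c\to\infty}\ \limsup_{n\to\infty}\ \frac{n}{\sup_{\sigma}\mathbf{labels}(\mathbf{alg},\sigma,\lfloor c\alpha\rfloor)},\qquad f^*(\alpha)=\sup_{\mathbf{alg}}f(\alpha,\mathbf{alg})$$ (the upper limits are limits whenever the limits exist). **Theorem.**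 For every $\alpha>0$, $$f^*(\alpha)\le\min\left(1,\frac{2\alpha}{1+\alpha}\right).$$ In particular, $f^*(\alpha)\le 2\alpha$ for every $\alpha>0$, and $f^*(\alpha)\to 0$ as $\alpha\to 0^+$ (at least linearly in $\alpha$). -/

import Mathlib

open Filter Topology
open scoped ENNReal

namespace DistributedLabeling

/-- `t` is a family of teachers `t 0, t 1, …` for `n` instances with true labels `y`, where
`t k i` is the name that teacher `k` gives to instance `i`.  Each teacher is consistent with the
true classes; nothing is assumed about the names that different teachers give to a class. -/
def ClassConsistent {n c : ℕ} (y : Fin n → Fin c) (t : ℕ → Fin n → Fin c) : Prop :=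
  ∀ k i j, t k i = t k j ↔ y i = y j

/-- A deterministic adaptive strategy for `n` instances and `c` classes: either stop and return
labels for all the instances, or ask a teacher for the label of one instance and continue in a way
that depends on the name received.  Sending a whole batch of instances to a teacher is the special
case in which the answers are not looked at until all of them have been received. -/
inductive Strategy (n c : ℕ) : Type
  | output (ybar : Fin n → ℕ) : Strategy n c
  | ask (teacher : ℕ) (x : Fin n) (next : Fin c → Strategy n c) : Strategy n c

namespace Strategy

/-- The queries (teacher, instance) made when the teachers are `t`, in order. -/
def queries {n c : ℕ} : Strategy n c → (ℕ → Fin n → Fin c) → List (ℕ × Fin n)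
  | output _, _ => []
  | ask k x next, t => (k, x) :: (next (t k x)).queries t

/-- The labels returned when the teachers are `t`. -/
def result {n c : ℕ} : Strategy n c → (ℕ → Fin n → Fin c) → Fin n → ℕ
  | output ybar, _ => ybar
  | ask k x next, t => (next (t k x)).result t

/-- No teacher is asked for more than `l` labels, whatever the true labels and the teachers are. -/
def RespectsBudget {n c : ℕ} (s : Strategy n c) (l : ℕ) : Prop :=
  ∀ (y : Fin n → Fin c) (t : ℕ → Fin n → Fin c), ClassConsistent y t →
    ∀ k : ℕ, ((s.queries t).map Prod.fst).count k ≤ l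

/-- The returned labels always induce the partition into the true classes. -/
def IsCorrect {n c : ℕ} (s : Strategy n c) : Prop :=
  ∀ (y : Fin n → Fin c) (t : ℕ → Fin n → Fin c), ClassConsistent y t →
    ∀ i j : Fin n, s.result t i = s.result t j ↔ y i = y j

end Strategy

/-- A (randomized) distributed labeling algorithm with completely uncoordinated teachers.  For `n`
instances, `c` classes and teachers that are willing to label `l` instances each, the internal
randomness selects a deterministic strategy.  As there are only countably many strategies, a
randomized strategy is the same as a `PMF` on them.  With `l ≤ 1` the task is impossible, as no
teacher ever compares two instances, so nothing is asked of the algorithm in that case. -/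
structure Algorithm where
  strategy : (n c l : ℕ) → PMF (Strategy n c)
  respectsBudget : ∀ n c l : ℕ, 2 ≤ l → ∀ s ∈ (strategy n c l).support, s.RespectsBudget l
  isCorrect : ∀ n c l : ℕ, 2 ≤ l → ∀ s ∈ (strategy n c l).support, s.IsCorrect

namespace Algorithm

/-- The number of labels, averaged over the internal randomness, that the algorithm obtains from
the teachers `t`. -/
noncomputable def expectedLabels (alg : Algorithm) {n c : ℕ} (l : ℕ)
    (t : ℕ → Fin n → Fin c) : ℝ≥0∞ :=
  ∑' s : Strategy n c, alg.strategy n c l s * ((s.queries t).length : ℝ≥0∞)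

/-- `labels(alg, σ, l)`: the average number of labels used on the input with true labels `y`.  As
the teachers are uncoordinated, the names they use may be any class consistent ones. -/
noncomputable def labels (alg : Algorithm) {n c : ℕ} (y : Fin n → Fin c) (l : ℕ) : ℝ≥0∞ :=
  ⨆ (t : ℕ → Fin n → Fin c) (_ : ClassConsistent y t), alg.expectedLabels l t

/-- The label efficiency `f(α, alg) = lim_{c → ∞} lim_{n → ∞} n / sup_σ labels(alg, σ, cα)`.
Upper limits are used, so that it is defined for every algorithm; they are the limits wherever
those exist.  A teacher labels a whole number of instances, hence `⌊cα⌋` of them. -/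
noncomputable def efficiency (alg : Algorithm) (α : ℝ) : ℝ≥0∞ :=
  limsup (fun c : ℕ =>
    limsup (fun n : ℕ =>
      (n : ℝ≥0∞) / ⨆ y : Fin n → Fin c, alg.labels y ⌊(c : ℝ) * α⌋₊) atTop) atTop

end Algorithm

/-- The optimal efficiency `f*(α) = sup_alg f(α, alg)`. -/
noncomputable def optimalEfficiency (α : ℝ) : ℝ≥0∞ :=
  ⨆ alg : Algorithm, alg.efficiency α

end DistributedLabeling

namespace DistributedLabeling

open Equiv

/-! The adversary is random: the first `c` instances represent all classes, the other labels are
uniform, and each teacher renames the classes by an independent uniform permutation. Fix an instance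
`x` outside the representatives. A class is alive while no teacher has labeled both `x` and another
instance of that class. Exchanging two alive classes in the permutations of the teachers that
labeled `x` preserves all answers, so alive classes are equally likely for `x`
(`card_compatible_eq`). Each label of `x` kills at most `l` classes (`le_card_aliveClasses`), and no
correct algorithm stops with two alive. So label number `j + 1` of `x` is needed with probability at
least about `1 - j * l / c`.

Summing over `j < R` and over the `n - c` free instances, then averaging over the internal
randomness, gives efficiency at most `1 / ∑ j < R, (1 - j * α)` in the limit. `R = 1` yields the
bound `1`; `R = ⌊1/α⌋ + 1` yields `2α / (1 + α)`. -/

/-- The family of permutations that is `π` on the first `K` teachers and trivial on the others. -/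
def extendPerm {K c : ℕ} (π : Fin K → Perm (Fin c)) (k : ℕ) : Perm (Fin c) :=
  if h : k < K then π ⟨k, h⟩ else 1

/-- The teachers that rename the true labels `y` by the permutations `π`. -/
def permTeacher {K n c : ℕ} (π : Fin K → Perm (Fin c)) (y : Fin n → Fin c) (k : ℕ) (i : Fin n) :
    Fin c :=
  extendPerm π k (y i)

theorem classConsistent_permTeacher {K n c : ℕ} (π : Fin K → Perm (Fin c)) (y : Fin n → Fin c) :
    ClassConsistent y (permTeacher π y) := by
  intro k i j
  simp [permTeacher]

/-- A strategy is a well-founded, finitely branching tree. Hence finitely many permutations suffice,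
and expectations become finite sums. -/
theorem Strategy.exists_teacher_lt {n c : ℕ} (s : Strategy n c) :
    ∃ K : ℕ, ∀ t, ∀ q ∈ s.queries t, q.1 < K := by
  induction s with
  | output ybar => exact ⟨0, fun t q hq => by simp [Strategy.queries] at hq⟩
  | ask k x next ih =>
    choose K hK using ih
    refine ⟨(k + 1) + ∑ b, K b, fun t q hq => ?_⟩
    rw [Strategy.queries, List.mem_cons] at hq
    rcases hq with rfl | hq
    · simp; omega
    · have h1 := hK _ t q hq
      have h2 : K (t k x) ≤ ∑ b, K b := Finset.single_le_sum (fun _ _ => Nat.zero_le _)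
        (Finset.mem_univ _)
      omega

/-- The number of queries about the instance `x`. -/
def Strategy.instanceQueries {n c : ℕ} (s : Strategy n c) (x : Fin n) (t : ℕ → Fin n → Fin c) : ℕ :=
  ((s.queries t).map Prod.snd).count x

theorem Strategy.sum_instanceQueries_le {n c : ℕ} (s : Strategy n c) (t : ℕ → Fin n → Fin c)
    (P : Finset (Fin n)) : ∑ x ∈ P, s.instanceQueries x t ≤ (s.queries t).length := by
  calc ∑ x ∈ P, s.instanceQueries x t ≤ ∑ x, s.instanceQueries x t :=
        Finset.sum_le_sum_of_subset (Finset.subset_univ P)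
    _ = (s.queries t).length := by
        have := Multiset.sum_count_eq_card (s := Finset.univ)
          (m := (((s.queries t).map Prod.snd : List (Fin n)) : Multiset (Fin n))) (by simp)
        simpa [Strategy.instanceQueries] using this

/-! ### Labels needed for one instance -/

section History

variable {K n c : ℕ}

/-- After the answers `h`, no teacher has labeled both `x` and another instance of the class `a`. -/
def Alive (y : Fin n → Fin c) (x : Fin n) (h : List (ℕ × Fin n × Fin c)) (a : Fin c) : Prop :=
  ∀ q ∈ h, ∀ q' ∈ h, q.1 = q'.1 → q.2.1 = x → q'.2.1 ≠ x → y q'.2.1 ≠ a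

open Classical in
/-- The classes that have not been compared with `x`. -/
noncomputable def aliveClasses (y : Fin n → Fin c) (x : Fin n) (h : List (ℕ × Fin n × Fin c)) :
    Finset (Fin c) :=
  Finset.univ.filter (Alive y x h)

open Classical in
/-- The families of permutations that give the answers `h` when `x` has the label `a`. -/
noncomputable def compatible (K : ℕ) (y : Fin n → Fin c) (x : Fin n)
    (h : List (ℕ × Fin n × Fin c)) (a : Fin c) : Finset (Fin K → Perm (Fin c)) :=
  Finset.univ.filter fun π =>
    ∀ q ∈ h, permTeacher π (Function.update y x a) q.1 q.2.1 = q.2.2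

theorem mem_aliveClasses {y : Fin n → Fin c} {x : Fin n} {h : List (ℕ × Fin n × Fin c)}
    {a : Fin c} : a ∈ aliveClasses y x h ↔ Alive y x h a := by
  simp [aliveClasses]

theorem mem_compatible {y : Fin n → Fin c} {x : Fin n} {h : List (ℕ × Fin n × Fin c)}
    {a : Fin c} {π : Fin K → Perm (Fin c)} : π ∈ compatible K y x h a ↔
      ∀ q ∈ h, permTeacher π (Function.update y x a) q.1 q.2.1 = q.2.2 := by
  simp [compatible]

open Classical in
/-- Exchange the names of the classes `a` and `a'` at the teachers that have labeled `x`. -/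
noncomputable def swapNames (x : Fin n) (h : List (ℕ × Fin n × Fin c)) (a a' : Fin c)
    (π : Fin K → Perm (Fin c)) : Fin K → Perm (Fin c) := fun k =>
  if ∃ q ∈ h, q.1 = k ∧ q.2.1 = x then π k * swap a a' else π k

theorem swapNames_injective (x : Fin n) (h : List (ℕ × Fin n × Fin c)) (a a' : Fin c) :
    Function.Injective (swapNames (K := K) x h a a') := by
  intro π π' hp
  funext k
  have := congrFun hp k
  unfold swapNames at this
  split_ifs at this
  · exact mul_right_cancel this
  · exact this

/-- At a teacher that labeled `x`, every other labeled instance lies outside `a` and `a'`, so the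
swap keeps its name, while `x` moved to `a'` gets the name `a` had. Elsewhere the class of `x` was
never seen. -/
theorem swapNames_mem {y : Fin n → Fin c} {x : Fin n} {h : List (ℕ × Fin n × Fin c)}
    {a a' : Fin c} (hK : ∀ q ∈ h, q.1 < K) (ha : Alive y x h a) (ha' : Alive y x h a')
    {π : Fin K → Perm (Fin c)} (hπ : π ∈ compatible K y x h a) :
    swapNames x h a a' π ∈ compatible K y x h a' := by
  rw [mem_compatible] at hπ ⊢
  intro q hq
  rw [← hπ q hq]
  have hk := hK q hq
  simp only [permTeacher, extendPerm, hk, dif_pos]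
  by_cases hx : ∃ q' ∈ h, q'.1 = q.1 ∧ q'.2.1 = x
  · rw [swapNames, if_pos hx]
    by_cases hqx : q.2.1 = x
    · simp [hqx]
    · obtain ⟨q', hq', h1, h2⟩ := hx
      have e1 := ha q' hq' q hq h1 h2 hqx
      have e2 := ha' q' hq' q hq h1 h2 hqx
      simp [Function.update_of_ne hqx, swap_apply_of_ne_of_ne e1 e2]
  · rw [swapNames, if_neg hx]
    have hqx : q.2.1 ≠ x := fun e => hx ⟨q, hq, rfl, e⟩
    simp [Function.update_of_ne hqx]

theorem card_compatible_eq {y : Fin n → Fin c} {x : Fin n} {h : List (ℕ × Fin n × Fin c)}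
    {a a' : Fin c} (hK : ∀ q ∈ h, q.1 < K) (ha : Alive y x h a) (ha' : Alive y x h a') :
    (compatible K y x h a).card = (compatible K y x h a').card :=
  le_antisymm
    (Finset.card_le_card_of_injOn _ (fun _ hπ => swapNames_mem hK ha ha' hπ)
      (swapNames_injective x h a a').injOn)
    (Finset.card_le_card_of_injOn _ (fun _ hπ => swapNames_mem hK ha' ha hπ)
      (swapNames_injective x h a' a).injOn)

/-- Every label obtained for `x` rules out at most `l` classes. -/
theorem le_card_aliveClasses (y : Fin n → Fin c) (x : Fin n) (h : List (ℕ × Fin n × Fin c))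
    (l : ℕ) (hl : ∀ k, (h.map Prod.fst).count k ≤ l) :
    c ≤ (aliveClasses y x h).card + (h.map fun q => q.2.1).count x * l := by
  classical
  have hsplit := Finset.card_filter_add_card_filter_not (s := (Finset.univ : Finset (Fin c)))
    (Alive y x h)
  rw [Finset.card_univ, Fintype.card_fin] at hsplit
  -- A dead class is the class of an instance labeled by a teacher that also labeled `x`; each such
  -- teacher accounts for at most `l` of them.
  have hsub : (Finset.univ.filter fun a => ¬ Alive y x h a) ⊆
      (h.filter fun q => q.2.1 = x).toFinset.biUnion fun q =>
        ((h.filter fun q' => q'.1 = q.1).map fun q' => y q'.2.1).toFinset := by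
    intro a ha
    simp only [Finset.mem_filter, Finset.mem_univ, true_and, Alive, not_forall] at ha
    obtain ⟨q, hq, q', hq', h1, h2, -, h3⟩ := ha
    simp only [Finset.mem_biUnion, List.mem_toFinset, List.mem_filter, List.mem_map,
      decide_eq_true_eq]
    exact ⟨q, ⟨hq, h2⟩, q', ⟨hq', h1.symm⟩, not_not.mp h3⟩
  have hcard := (Finset.card_le_card hsub).trans (Finset.card_biUnion_le_card_mul _ _ l ?_)
  · have h2 : (h.filter fun q => q.2.1 = x).toFinset.card ≤ (h.map fun q => q.2.1).count x := by
      refine (List.toFinset_card_le _).trans (le_of_eq ?_)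
      rw [List.count, List.countP_map, List.countP_eq_length_filter]
      congr 1
    have := Nat.mul_le_mul_right l h2
    unfold aliveClasses
    omega
  · intro q _
    refine (List.toFinset_card_le _).trans ?_
    rw [List.length_map]
    refine le_trans (le_of_eq ?_) (hl q.1)
    rw [List.count, List.countP_map, List.countP_eq_length_filter]
    congr 1

/-- The number of classes that must be left after `j` labels for `x`, or zero when elimination may
identify the class of `x`. -/
def openClasses (c l j : ℕ) : ℕ := if 2 ≤ c - j * l then c - j * l else 0

theorem sum_openClasses_eq_zero {l r R : ℕ} (hr : c - r * l ≤ 1) :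
    ∑ j ∈ Finset.Ico r R, openClasses c l j = 0 := by
  refine Finset.sum_eq_zero fun j hj => ?_
  have := Nat.mul_le_mul_right l (Finset.mem_Ico.mp hj).1
  rw [openClasses, if_neg (by omega)]

theorem Alive.of_cons {y : Fin n → Fin c} {x : Fin n} {h : List (ℕ × Fin n × Fin c)}
    {q : ℕ × Fin n × Fin c} {a : Fin c} (ha : Alive y x (q :: h) a) : Alive y x h a :=
  fun q₁ h₁ q₂ h₂ => ha q₁ (List.mem_cons_of_mem _ h₁) q₂ (List.mem_cons_of_mem _ h₂)

theorem Alive.cons_congr {y : Fin n → Fin c} {x : Fin n} {h : List (ℕ × Fin n × Fin c)}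
    {k : ℕ} {z : Fin n} (b b' : Fin c) {a : Fin c} (ha : Alive y x ((k, z, b) :: h) a) :
    Alive y x ((k, z, b') :: h) a := by
  intro q₁ h₁ q₂ h₂
  rw [List.mem_cons] at h₁ h₂
  rcases h₁ with rfl | h₁ <;> rcases h₂ with rfl | h₂
  · exact ha (k, z, b) List.mem_cons_self (k, z, b) List.mem_cons_self
  · exact ha (k, z, b) List.mem_cons_self _ (List.mem_cons_of_mem _ h₂)
  · exact ha _ (List.mem_cons_of_mem _ h₁) (k, z, b) List.mem_cons_self
  · exact ha _ (List.mem_cons_of_mem _ h₁) _ (List.mem_cons_of_mem _ h₂)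

theorem mem_compatible_cons {y : Fin n → Fin c} {x : Fin n} {h : List (ℕ × Fin n × Fin c)}
    {k : ℕ} {z : Fin n} {a b : Fin c} {π : Fin K → Perm (Fin c)} :
    π ∈ compatible K y x ((k, z, b) :: h) a ↔
      permTeacher π (Function.update y x a) k z = b ∧ π ∈ compatible K y x h a := by
  simp [mem_compatible]

/-- The next answer splits the compatible families of permutations. -/
theorem sum_compatible_cons {M : Type*} [AddCommMonoid M] (y : Fin n → Fin c) (x : Fin n)
    (h : List (ℕ × Fin n × Fin c)) (k : ℕ) (z : Fin n) (a : Fin c)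
    (F : (Fin K → Perm (Fin c)) → M) :
    ∑ b, ∑ π ∈ compatible K y x ((k, z, b) :: h) a, F π = ∑ π ∈ compatible K y x h a, F π := by
  classical
  rw [← Finset.sum_fiberwise (compatible K y x h a)
    (fun π => permTeacher π (Function.update y x a) k z)]
  refine Finset.sum_congr rfl fun b _ => Finset.sum_congr ?_ fun _ _ => rfl
  ext π
  rw [mem_compatible_cons, Finset.mem_filter, and_comm]

/-- The expected number of labels for `x` that are still needed after the answers `h`, when the
class of `x` is random. -/
theorem card_mul_sum_openClasses_le (y : Fin n → Fin c) (x : Fin n) (l R : ℕ)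
    (hrep : ∀ a, ∃ z, z ≠ x ∧ y z = a) (s : Strategy n c) :
    ∀ h : List (ℕ × Fin n × Fin c), (∀ q ∈ h, q.1 < K) →
      (∀ a ∈ aliveClasses y x h, ∀ π ∈ compatible K y x h a,
        (∀ q ∈ s.queries (permTeacher π (Function.update y x a)), q.1 < K) ∧
        (∀ k, (h.map Prod.fst).count k +
          ((s.queries (permTeacher π (Function.update y x a))).map Prod.fst).count k ≤ l) ∧
        ∀ i j, s.result (permTeacher π (Function.update y x a)) i =
            s.result (permTeacher π (Function.update y x a)) j ↔
          Function.update y x a i = Function.update y x a j) →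
      ∀ a₀ ∈ aliveClasses y x h,
        (compatible K y x h a₀).card *
            ∑ j ∈ Finset.Ico ((h.map fun q => q.2.1).count x) R, openClasses c l j ≤
          ∑ a ∈ aliveClasses y x h, ∑ π ∈ compatible K y x h a,
            s.instanceQueries x (permTeacher π (Function.update y x a)) := by
  induction s with
  | output ybar =>
    intro h hK hs a₀ ha₀
    rcases (compatible K y x h a₀).eq_empty_or_nonempty with he | ⟨π, hπ⟩
    · simp [he]
    have hone : (aliveClasses y x h).card ≤ 1 := by
      rw [Finset.card_le_one]
      have key : ∀ a ∈ aliveClasses y x h, a = a₀ := by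
        intro a ha
        obtain ⟨z, hz, hza⟩ := hrep a
        have h1 := (hs a ha _ (swapNames_mem hK (mem_aliveClasses.mp ha₀)
          (mem_aliveClasses.mp ha) hπ)).2.2 z x
        have h2 := (hs a₀ ha₀ π hπ).2.2 z x
        simp only [Strategy.result, Function.update_self, Function.update_of_ne hz, hza] at h1 h2
        exact h2.mp (h1.mpr trivial)
      intro a ha b hb
      rw [key a ha, key b hb]
    have hb := le_card_aliveClasses y x h l fun k =>
      (Nat.le_add_right _ _).trans ((hs a₀ ha₀ π hπ).2.1 k)
    rw [sum_openClasses_eq_zero (by omega)]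
    simp
  | ask k z next ih =>
    intro h hK hs a₀ ha₀
    rcases (compatible K y x h a₀).eq_empty_or_nonempty with he | ⟨π₀, hπ₀⟩
    · simp [he]
    obtain ⟨hk₀, hl₀, -⟩ := hs a₀ ha₀ π₀ hπ₀
    have hkK : k < K := hk₀ (k, z) (by simp [Strategy.queries])
    have hc := fun b => le_card_aliveClasses y x ((k, z, b) :: h) l fun k' => by
      have := hl₀ k'
      simp only [Strategy.queries, List.map_cons, List.count_cons] at this ⊢
      omega
    -- Aliveness ignores the names received, so the sums over answers and over alive classes can be
    -- exchanged.
    have halive : ∀ b, aliveClasses y x ((k, z, b) :: h) = aliveClasses y x ((k, z, a₀) :: h) := by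
      intro b
      ext a
      simp only [mem_aliveClasses]
      exact ⟨Alive.cons_congr b a₀, Alive.cons_congr a₀ b⟩
    have hsub : aliveClasses y x ((k, z, a₀) :: h) ⊆ aliveClasses y x h := fun a ha =>
      mem_aliveClasses.mpr (mem_aliveClasses.mp ha).of_cons
    set r := (h.map fun q => q.2.1).count x with hr
    have hcount : ∀ b, (((k, z, b) :: h).map fun q => q.2.1).count x =
        r + if z = x then 1 else 0 := by
      intro b
      simp [List.count_cons, hr]
    have hrest : (compatible K y x h a₀).card *
        ∑ j ∈ Finset.Ico (r + if z = x then 1 else 0) R, openClasses c l j ≤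
        ∑ a ∈ aliveClasses y x h, ∑ π ∈ compatible K y x h a,
          (next (permTeacher π (Function.update y x a) k z)).instanceQueries x
            (permTeacher π (Function.update y x a)) := by
      -- The query may kill `a₀`, so the induction hypothesis is used at a surviving `a₁`. With no
      -- survivor, `l` times the number of labels of `x` is at least `c` and the remaining sum
      -- vanishes.
      rcases (aliveClasses y x ((k, z, a₀) :: h)).eq_empty_or_nonempty with he | ⟨a₁, ha₁⟩
      · have := hc a₀
        rw [he, Finset.card_empty, hcount] at this
        rw [sum_openClasses_eq_zero (by omega)]
        simp
      have hstep : ∀ b, (compatible K y x ((k, z, b) :: h) a₁).card *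
          ∑ j ∈ Finset.Ico (r + if z = x then 1 else 0) R, openClasses c l j ≤
          ∑ a ∈ aliveClasses y x ((k, z, a₀) :: h), ∑ π ∈ compatible K y x ((k, z, b) :: h) a,
            (next b).instanceQueries x (permTeacher π (Function.update y x a)) := by
        intro b
        have := ih b ((k, z, b) :: h) ?_ ?_ a₁ (by rwa [halive b])
        · rwa [halive b, hcount] at this
        · intro q hq
          rcases List.mem_cons.mp hq with rfl | hq
          · exact hkK
          · exact hK q hq
        · intro a ha π hπ
          rw [halive b] at ha
          obtain ⟨hb, hπ'⟩ := mem_compatible_cons.mp hπ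
          obtain ⟨h1, h2, h3⟩ := hs a (hsub ha) π hπ'
          simp only [Strategy.queries, Strategy.result, hb] at h1 h2 h3
          refine ⟨fun q hq => h1 q (List.mem_cons_of_mem _ hq), fun k' => ?_, h3⟩
          have := h2 k'
          simp only [List.map_cons, List.count_cons] at this ⊢
          omega
      calc _ = ∑ b, (compatible K y x ((k, z, b) :: h) a₁).card *
            ∑ j ∈ Finset.Ico (r + if z = x then 1 else 0) R, openClasses c l j := by
            rw [← Finset.sum_mul, card_compatible_eq hK (mem_aliveClasses.mp ha₀)
              (mem_aliveClasses.mp (hsub ha₁))]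
            simp only [Finset.card_eq_sum_ones, sum_compatible_cons]
        _ ≤ ∑ b, ∑ a ∈ aliveClasses y x ((k, z, a₀) :: h),
            ∑ π ∈ compatible K y x ((k, z, b) :: h) a,
              (next b).instanceQueries x (permTeacher π (Function.update y x a)) :=
            Finset.sum_le_sum fun b _ => hstep b
        _ = ∑ a ∈ aliveClasses y x ((k, z, a₀) :: h), ∑ π ∈ compatible K y x h a,
              (next (permTeacher π (Function.update y x a) k z)).instanceQueries x
                (permTeacher π (Function.update y x a)) := by
            rw [Finset.sum_comm]
            refine Finset.sum_congr rfl fun a _ => ?_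
            rw [← sum_compatible_cons y x h k z a]
            refine Finset.sum_congr rfl fun b _ => Finset.sum_congr rfl fun π hπ => ?_
            rw [(mem_compatible_cons.mp hπ).1]
        _ ≤ _ := Finset.sum_le_sum_of_subset hsub
    have hask : ∀ t, (Strategy.ask k z next).instanceQueries x t =
        (if z = x then 1 else 0) + (next (t k z)).instanceQueries x t := by
      intro t
      simp [Strategy.instanceQueries, Strategy.queries, List.count_cons, add_comm]
    simp only [hask, Finset.sum_add_distrib]
    refine le_trans ?_ (Nat.add_le_add_left hrest _)
    split_ifs with hz
    -- A query about `x` counts once for every alive class and compatible family; this pays for the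
    -- term `j = r`.
    · have hh := le_card_aliveClasses y x h l fun k' => (Nat.le_add_right _ _).trans (hl₀ k')
      rw [← hr] at hh
      have hopen : openClasses c l r ≤ (aliveClasses y x h).card := by
        unfold openClasses
        split_ifs <;> omega
      have hsum : ∑ a ∈ aliveClasses y x h, ∑ π ∈ compatible K y x h a, 1 =
          (aliveClasses y x h).card * (compatible K y x h a₀).card := by
        simp only [← Finset.card_eq_sum_ones]
        rw [← smul_eq_mul, ← Finset.sum_const]
        exact Finset.sum_congr rfl fun a ha =>
          card_compatible_eq hK (mem_aliveClasses.mp ha) (mem_aliveClasses.mp ha₀)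
      rw [hsum, mul_comm (aliveClasses y x h).card, ← mul_add]
      refine Nat.mul_le_mul_left _ ?_
      rcases lt_or_ge r R with hrR | hrR
      · rw [Finset.sum_eq_sum_Ico_succ_bot hrR]
        omega
      · simp [Finset.Ico_eq_empty_of_le hrR]
    · simp

theorem Strategy.card_mul_sum_openClasses_le {s : Strategy n c} {l : ℕ} (hb : s.RespectsBudget l)
    (hs : s.IsCorrect) (hK : ∀ t, ∀ q ∈ s.queries t, q.1 < K) (y : Fin n → Fin c) (x : Fin n)
    (hrep : ∀ a, ∃ z, z ≠ x ∧ y z = a) (R : ℕ) :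
    Fintype.card (Fin K → Perm (Fin c)) * ∑ j ∈ Finset.range R, openClasses c l j ≤
      ∑ a, ∑ π : Fin K → Perm (Fin c),
        s.instanceQueries x (permTeacher π (Function.update y x a)) := by
  have hA : aliveClasses y x [] = Finset.univ := by
    ext a; simp [mem_aliveClasses, Alive]
  have hC : ∀ a, compatible K y x [] a = Finset.univ := by
    intro a; ext π; simp [mem_compatible]
  have := DistributedLabeling.card_mul_sum_openClasses_le (K := K) y x l R hrep s [] (by simp)
    (fun a _ π _ => ⟨hK _, fun k => by
      simpa using hb _ _ (classConsistent_permTeacher π (Function.update y x a)) k,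
      hs _ _ (classConsistent_permTeacher π (Function.update y x a))⟩) (y x) (by simp [hA])
  simpa [hA, hC] using this

end History

/-! ### Averaging over labels, teachers and internal randomness -/

/-- Resampling one coordinate does not change an average. -/
theorem sum_sum_update {n c : ℕ} (x : Fin n) (F : (Fin n → Fin c) → ℕ) :
    ∑ w, ∑ a, F (Function.update w x a) = c * ∑ w, F w := by
  -- Exchanging the stored coordinate with the fresh one is a bijection.
  have hinv : Function.Involutive fun p : (Fin n → Fin c) × Fin c =>
      (Function.update p.1 x p.2, p.1 x) := by
    rintro ⟨w, a⟩
    simp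
  have := Equiv.sum_comp hinv.toPerm fun p : (Fin n → Fin c) × Fin c => F p.1
  simp only [Fintype.sum_prod_type, Function.Involutive.coe_toPerm] at this
  rw [this]
  simp [Finset.mul_sum]

/-- The labels `w`, except that the first `c` instances represent the `c` classes. -/
def withRepresentatives {n c : ℕ} (w : Fin n → Fin c) (i : Fin n) : Fin c :=
  if h : i.1 < c then ⟨i, h⟩ else w i

theorem withRepresentatives_update {n c : ℕ} (w : Fin n → Fin c) {x : Fin n} (hx : c ≤ x.1)
    (a : Fin c) : withRepresentatives (Function.update w x a) =
      Function.update (withRepresentatives w) x a := by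
  funext i
  by_cases hi : i = x
  · subst hi
    simp [withRepresentatives, hx]
  · simp [withRepresentatives, hi]

theorem Strategy.le_sum_length {K n c l : ℕ} {s : Strategy n c} (hb : s.RespectsBudget l)
    (hs : s.IsCorrect) (hK : ∀ t, ∀ q ∈ s.queries t, q.1 < K) (R : ℕ) :
    (n - c) * (Fintype.card ((Fin n → Fin c) × (Fin K → Perm (Fin c))) *
      ∑ j ∈ Finset.range R, openClasses c l j) ≤
    c * ∑ p : (Fin n → Fin c) × (Fin K → Perm (Fin c)),
      (s.queries (permTeacher p.2 (withRepresentatives p.1))).length := by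
  set P : Finset (Fin n) := Finset.univ.filter fun x => c ≤ x.1 with hP
  have hcard : n - c ≤ P.card := by
    have h1 := Finset.card_filter_add_card_filter_not (s := (Finset.univ : Finset (Fin n)))
      (fun x => c ≤ x.1)
    have h2 : (Finset.univ.filter fun x : Fin n => ¬ c ≤ x.1).card ≤ (Finset.range c).card :=
      Finset.card_le_card_of_injOn (fun x => x.1) (by intro x; simp) Fin.val_injective.injOn
    rw [Finset.card_univ, Fintype.card_fin, ← hP] at h1
    rw [Finset.card_range] at h2
    omega
  have hx : ∀ x ∈ P, Fintype.card ((Fin n → Fin c) × (Fin K → Perm (Fin c))) *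
      ∑ j ∈ Finset.range R, openClasses c l j ≤
      c * ∑ p : (Fin n → Fin c) × (Fin K → Perm (Fin c)),
        s.instanceQueries x (permTeacher p.2 (withRepresentatives p.1)) := by
    intro x hxP
    have hcx : c ≤ x.1 := (Finset.mem_filter.mp hxP).2
    rw [Fintype.sum_prod_type, ← sum_sum_update x, Fintype.card_prod, mul_assoc,
      ← Finset.card_univ (α := Fin n → Fin c), ← smul_eq_mul, ← Finset.sum_const]
    refine Finset.sum_le_sum fun w _ => ?_
    simp only [withRepresentatives_update w hcx]
    refine s.card_mul_sum_openClasses_le hb hs hK _ x (fun a => ?_) R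
    refine ⟨⟨a, by omega⟩, fun h => ?_, by simp [withRepresentatives]⟩
    have := congrArg Fin.val h
    simp at this
    omega
  calc _ ≤ P.card * _ := Nat.mul_le_mul_right _ hcard
    _ = ∑ x ∈ P, _ := by rw [Finset.sum_const, smul_eq_mul]
    _ ≤ ∑ x ∈ P, c * ∑ p : (Fin n → Fin c) × (Fin K → Perm (Fin c)),
        s.instanceQueries x (permTeacher p.2 (withRepresentatives p.1)) := Finset.sum_le_sum hx
    _ = c * ∑ p : (Fin n → Fin c) × (Fin K → Perm (Fin c)), ∑ x ∈ P,
        s.instanceQueries x (permTeacher p.2 (withRepresentatives p.1)) := by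
        rw [← Finset.mul_sum, Finset.sum_comm]
    _ ≤ _ := Nat.mul_le_mul_left _ (Finset.sum_le_sum fun p _ => s.sum_instanceQueries_le _ P)

/-- A lower bound for the number of labels of a randomized algorithm in the worst case. -/
theorem Algorithm.le_mul_iSup_labels (alg : Algorithm) {n c l : ℕ} (hl : 2 ≤ l) (R : ℕ) :
    (((n - c) * ∑ j ∈ Finset.range R, openClasses c l j : ℕ) : ℝ≥0∞) ≤
      c * ⨆ y : Fin n → Fin c, alg.labels y l := by
  classical
  rcases Nat.eq_zero_or_pos c with rfl | hc
  · simp [openClasses]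
  set B := ⨆ y : Fin n → Fin c, alg.labels y l with hB
  set N : ℕ := (n - c) * ∑ j ∈ Finset.range R, openClasses c l j with hN
  -- A finite set of strategies has a common teacher bound `K`, hence one finite probability space
  -- for all of them.
  have hfin : ∀ F : Finset (Strategy n c), ∑ s ∈ F, alg.strategy n c l s * (N : ℝ≥0∞) ≤ c * B := by
    intro F
    choose K' hK' using fun s : Strategy n c => s.exists_teacher_lt
    set K := F.sup K'
    let Ω := (Fin n → Fin c) × (Fin K → Perm (Fin c))
    have : Nonempty Ω := ⟨(fun _ => ⟨0, hc⟩, fun _ => 1)⟩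
    have hs : ∀ s ∈ F, alg.strategy n c l s * ((Fintype.card Ω : ℝ≥0∞) * N) ≤
        c * ∑ p : Ω, alg.strategy n c l s *
          ((s.queries (permTeacher p.2 (withRepresentatives p.1))).length : ℝ≥0∞) := by
      intro s hsF
      by_cases hsup : s ∈ (alg.strategy n c l).support
      · rw [← Finset.mul_sum, mul_left_comm (c : ℝ≥0∞)]
        refine mul_le_mul_right ?_ _
        have := Strategy.le_sum_length (K := K) (alg.respectsBudget n c l hl s hsup)
          (alg.isCorrect n c l hl s hsup)
          (fun t q hq => (hK' s t q hq).trans_le (Finset.le_sup (f := K') hsF)) R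
        rw [mul_left_comm, ← hN] at this
        exact_mod_cast this
      · simp [(PMF.apply_eq_zero_iff _ _).mpr hsup]
    have hp : ∀ p : Ω, ∑ s ∈ F, alg.strategy n c l s *
        ((s.queries (permTeacher p.2 (withRepresentatives p.1))).length : ℝ≥0∞) ≤ B := by
      intro p
      refine (ENNReal.sum_le_tsum F).trans ?_
      refine le_trans ?_ (le_iSup (fun y : Fin n → Fin c => alg.labels y l)
        (withRepresentatives p.1))
      exact le_iSup₂ (f := fun t (_ : ClassConsistent (withRepresentatives p.1) t) =>
        alg.expectedLabels l t) _ (classConsistent_permTeacher p.2 (withRepresentatives p.1))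
    have hmul : (Fintype.card Ω : ℝ≥0∞) * ∑ s ∈ F, alg.strategy n c l s * (N : ℝ≥0∞) ≤
        Fintype.card Ω * (c * B) := by
      calc _ = ∑ s ∈ F, alg.strategy n c l s * ((Fintype.card Ω : ℝ≥0∞) * N) := by
            rw [Finset.mul_sum]
            exact Finset.sum_congr rfl fun s _ => mul_left_comm _ _ _
        _ ≤ _ := Finset.sum_le_sum hs
        _ = c * ∑ p : Ω, ∑ s ∈ F, alg.strategy n c l s *
            ((s.queries (permTeacher p.2 (withRepresentatives p.1))).length : ℝ≥0∞) := by
            rw [← Finset.mul_sum, Finset.sum_comm]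
        _ ≤ c * ∑ p : Ω, B := mul_le_mul_right (Finset.sum_le_sum fun p _ => hp p) _
        _ = _ := by
            rw [Finset.sum_const, nsmul_eq_mul, Finset.card_univ, mul_left_comm]
    exact (ENNReal.mul_le_mul_iff_right (by simp) (ENNReal.natCast_ne_top _)).mp hmul
  calc (N : ℝ≥0∞) = ∑' s, alg.strategy n c l s * (N : ℝ≥0∞) := by
        rw [ENNReal.tsum_mul_right, PMF.tsum_coe, one_mul]
    _ ≤ c * B := ENNReal.summable.tsum_le_of_sum_le hfin

/-! ### Limits in `n` and `c`, and the choice of `R` -/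

theorem le_sum_openClasses {c l R : ℕ} {α : ℝ} (hl : (l : ℝ) ≤ c * α) :
    c * ∑ j ∈ Finset.range R, (1 - j * α) - R ≤
      ((∑ j ∈ Finset.range R, openClasses c l j : ℕ) : ℝ) := by
  push_cast
  have : c * ∑ j ∈ Finset.range R, (1 - j * α) - R =
      ∑ j ∈ Finset.range R, (c * (1 - j * α) - 1 : ℝ) := by
    rw [Finset.mul_sum, Finset.sum_sub_distrib]
    simp
  rw [this]
  refine Finset.sum_le_sum fun j _ => ?_
  have h1 : (j : ℝ) * l ≤ j * (c * α) := mul_le_mul_of_nonneg_left hl (Nat.cast_nonneg j)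
  -- The cutoff at two classes costs at most one per term, hence `R` in total, negligible against
  -- `c`.
  have h2 : c - j * l - 1 ≤ openClasses c l j := by
    unfold openClasses
    split_ifs <;> omega
  have h3 : c ≤ openClasses c l j + j * l + 1 := by omega
  have h4 : (c : ℝ) ≤ openClasses c l j + j * l + 1 := by exact_mod_cast h3
  nlinarith

theorem Algorithm.limsup_le (alg : Algorithm) {c l G R : ℕ} (hl : 2 ≤ l)
    (hG : G = ∑ j ∈ Finset.range R, openClasses c l j) (hG0 : 0 < G) (hc : 0 < c) :
    limsup (fun n : ℕ => (n : ℝ≥0∞) / ⨆ y : Fin n → Fin c, alg.labels y l) atTop ≤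
      ENNReal.ofReal (c / G) := by
  have hlim : Tendsto (fun n : ℕ => ENNReal.ofReal ((n : ℝ) / (n + (-c : ℝ)) * (c / G))) atTop
      (𝓝 (ENNReal.ofReal (c / G))) := by
    refine ENNReal.tendsto_ofReal ?_
    simpa using (tendsto_natCast_div_add_atTop (-c : ℝ)).mul_const ((c : ℝ) / G)
  rw [← hlim.limsup_eq]
  refine limsup_le_limsup ?_
  filter_upwards [eventually_gt_atTop c] with n hn
  have hmain := alg.le_mul_iSup_labels (n := n) (c := c) hl R
  rw [← hG] at hmain
  set B := ⨆ y : Fin n → Fin c, alg.labels y l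
  have hn' : (0 : ℝ) < n + (-c : ℝ) := by
    have : (c : ℝ) < n := by exact_mod_cast hn
    linarith
  have hG' : (0 : ℝ) < G := by exact_mod_cast hG0
  have hc' : (0 : ℝ) < c := by exact_mod_cast hc
  have hBlow : ENNReal.ofReal ((n + (-c : ℝ)) * G / c) ≤ B := by
    rw [ENNReal.ofReal_div_of_pos hc', ENNReal.ofReal_natCast]
    refine ENNReal.div_le_of_le_mul' (le_trans (le_of_eq ?_) hmain)
    rw [← ENNReal.ofReal_natCast]
    congr 1
    push_cast [hn.le]
    ring
  calc (n : ℝ≥0∞) / B ≤ n / ENNReal.ofReal ((n + (-c : ℝ)) * G / c) :=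
        ENNReal.div_le_div_left hBlow _
    _ = _ := by
        rw [← ENNReal.ofReal_natCast, ← ENNReal.ofReal_div_of_pos (by positivity)]
        congr 1
        field_simp

theorem Algorithm.efficiency_le (alg : Algorithm) {α : ℝ} (hα : 0 < α) {R : ℕ}
    (hθ : 0 < ∑ j ∈ Finset.range R, (1 - j * α)) :
    alg.efficiency α ≤ ENNReal.ofReal (∑ j ∈ Finset.range R, (1 - j * α))⁻¹ := by
  set θ := ∑ j ∈ Finset.range R, (1 - j * α) with hθdef
  have hlim' : Tendsto (fun c : ℕ => θ - (R : ℝ) / c) atTop (𝓝 θ) := by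
    simpa using tendsto_const_nhds.sub (tendsto_const_div_atTop_nhds_zero_nat (R : ℝ))
  have hlim : Tendsto (fun c : ℕ => ENNReal.ofReal (θ - (R : ℝ) / c)⁻¹) atTop
      (𝓝 (ENNReal.ofReal θ⁻¹)) := ENNReal.tendsto_ofReal (hlim'.inv₀ hθ.ne')
  rw [← hlim.limsup_eq]
  refine limsup_le_limsup ?_
  have hlarge : ∀ᶠ c : ℕ in atTop, 2 ≤ (c : ℝ) * α :=
    (tendsto_natCast_atTop_atTop.atTop_mul_const hα).eventually_ge_atTop 2
  filter_upwards [hlarge, eventually_gt_atTop 0, hlim'.eventually (lt_mem_nhds hθ)] with c h2 hc hpos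
  have hc' : (0 : ℝ) < c := by exact_mod_cast hc
  have hG := le_sum_openClasses (c := c) (R := R) (Nat.floor_le (by positivity : 0 ≤ c * α))
  rw [← hθdef] at hG
  have hpos' : 0 < (c : ℝ) * θ - R := by
    have : (c : ℝ) * θ - R = c * (θ - R / c) := by field_simp
    rw [this]
    exact mul_pos hc' hpos
  refine (alg.limsup_le (Nat.le_floor (by exact_mod_cast h2)) rfl
    (by exact_mod_cast hpos'.trans_le hG) hc).trans (ENNReal.ofReal_le_ofReal ?_)
  calc (c : ℝ) / _ ≤ c / (c * θ - R) := div_le_div_of_nonneg_left hc'.le hpos' hG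
    _ = _ := by
      rw [show (c : ℝ) * θ - R = c * (θ - R / c) by field_simp]
      field_simp

theorem optimalEfficiency_le {α : ℝ} (hα : 0 < α) :
    optimalEfficiency α ≤ ENNReal.ofReal (min 1 (2 * α / (1 + α))) := by
  refine iSup_le fun alg => ?_
  rw [ENNReal.ofReal_min]
  refine le_min ?_ ?_
  · simpa using alg.efficiency_le hα (R := 1) (by simp)
  -- The terms `1 - j * α` are nonnegative exactly for `j ≤ N`, so `N + 1` terms maximize the sum.
  · set N := ⌊α⁻¹⌋₊ with hN
    have h1 : (N : ℝ) * α ≤ 1 := by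
      have := Nat.floor_le (inv_pos.mpr hα).le
      rwa [← hN, ← one_div, le_div_iff₀ hα] at this
    have h2 : 1 < (N + 1) * α := by
      have := Nat.lt_floor_add_one α⁻¹
      rw [← hN] at this
      exact (inv_lt_iff_one_lt_mul₀ hα).mp this
    have hsum : ∑ j ∈ Finset.range (N + 1), (1 - j * α) = (N + 1) * (1 - N * α / 2) := by
      generalize N = M
      induction M with
      | zero => simp
      | succ M ih => rw [Finset.sum_range_succ, ih]; push_cast; ring
    have hge : (1 + α) / (2 * α) ≤ ∑ j ∈ Finset.range (N + 1), (1 - j * α) := by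
      rw [hsum, div_le_iff₀ (by positivity)]
      -- After clearing denominators, the difference of the two sides is exactly `(1 - N * α) * ((N
      -- + 1) * α - 1)`.
      nlinarith [mul_nonneg (sub_nonneg.mpr h1) (sub_nonneg.mpr h2.le)]
    have hpos : 0 < (1 + α) / (2 * α) := by positivity
    refine (alg.efficiency_le hα (hpos.trans_le hge)).trans (ENNReal.ofReal_le_ofReal ?_)
    rw [← inv_div]
    exact inv_anti₀ hpos hge

theorem optimalEfficiency_le_two_mul {α : ℝ} (hα : 0 < α) :
    optimalEfficiency α ≤ ENNReal.ofReal (2 * α) := by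
  refine (optimalEfficiency_le hα).trans (ENNReal.ofReal_le_ofReal ((min_le_right _ _).trans ?_))
  exact div_le_self (by positivity) (by linarith)

end DistributedLabeling

theorem mainTheorem2 :
    (∀ α : ℝ, 0 < α →
      DistributedLabeling.optimalEfficiency α ≤ ENNReal.ofReal (min 1 (2 * α / (1 + α)))) ∧
    (∀ α : ℝ, 0 < α → DistributedLabeling.optimalEfficiency α ≤ ENNReal.ofReal (2 * α)) ∧
    Tendsto DistributedLabeling.optimalEfficiency (𝓝[>] 0) (𝓝 0) := by
  refine ⟨fun α hα => DistributedLabeling.optimalEfficiency_le hα,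
    fun α hα => DistributedLabeling.optimalEfficiency_le_two_mul hα, ?_⟩
  have hlim : Tendsto (fun α : ℝ => ENNReal.ofReal (2 * α)) (𝓝[>] 0) (𝓝 0) := by
    have : Tendsto (fun α : ℝ => ENNReal.ofReal (2 * α)) (𝓝 0) (𝓝 (ENNReal.ofReal (2 * 0))) :=
      ENNReal.tendsto_ofReal (tendsto_id.const_mul 2)
    simpa using this.mono_left nhdsWithin_le_nhds
  exact tendsto_of_tendsto_of_tendsto_of_le_of_le' tendsto_const_nhds hlim
    (Eventually.of_forall fun _ => zero_le)
    (eventually_nhdsWithin_of_forall fun α hα =>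
      DistributedLabeling.optimalEfficiency_le_two_mul hα)
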